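/- **Definitions.** An infinite real matrix $r=(r_{i,j})_{i,j\ge 1}$ is a *distance matrix* if $r_{i,i}=0$, $r_{i,j}=r_{j,i}\ge 0$ and $r_{i,j}\le r_{i,k}+r_{k,j}$ for all $i,j,k$; it is *proper* if $r_{i,j}\neq 0$ for $i\ne j$, so that $r$ is a metric on $\mathbb N$. It is *universal* if for every $\varepsilon>0$, every $n$, and every vector $a\in\mathbb R^n$ with $|a_i-a_j|\le r_{i,j}\le a_i+a_j$ for all $i,j\le n$, there is $m\in\mathbb N$ with $|r_{i,m}-a_i|<\varepsilon$ for all $i\le n$. A *Polish space* is a complete separable metric space. A *Urysohn space* is a Polish space $\mathcal U$ with the following two properties. 1) (Universality.) Every Polish space embeds isometrically in $\mathcal U$. 2) (Homogeneity.) If $a_1,\dots,a_m$ and $b_1,\dots,b_m$ are points of $\mathcal U$ with $\rho(a_i,a_j)=\rho(b_i,b_j)$ for all $i,j$, then there is an isometry $J$ of $\mathcal U$ onto itself with $J(a_i)=b_i$ for all $i$. Consider also the following property. 2′) For every finite subset $F\subset\mathcal U$ and every isometric embedding $i:F\to F'$ in a finite metric space $F'$, there is an isometric embedding $I:F'\to\mathcal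 U$ such that $I\circ i$ is the identity on $F$. **Theorem 3.** (1) If $r$ is a universal proper distance matrix, then the completion $\mathcal U_r$ of $(\mathbb N,r)$ is a Polish space with properties 1), 2) and 2′); every Urysohn space is isometric to $\mathcal U_r$, so $\mathcal U_r$ is the Urysohn space. (2) For any two universal proper distance matrices $r$ and $r'$, the completions of $(\mathbb N,r)$ and $(\mathbb N,r')$ are isometric. (3) Let $X$ be a Polish space and $(x_i)_{i\ge1}$ a sequence of points of $X$ whose terms are dense in $X$ (for instance an enumeration of a countable dense subset). Then the distance matrix $(\rho(x_i,x_j))_{i,j}$ is universal if and only if $X$ is a Urysohn space. -/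

import Mathlib

universe u v

/-- The cone `𝓡` of infinite distance matrices (rows and columns are numbered from `0`); zeros off
the main diagonal are allowed. -/
structure DistanceMatrix where
  entry : ℕ → ℕ → ℝ
  diag : ∀ i, entry i i = 0
  nonneg : ∀ i j, 0 ≤ entry i j
  symm : ∀ i j, entry i j = entry j i
  triangle : ∀ i j k, entry i j ≤ entry i k + entry k j

namespace DistanceMatrix

/-- A distance matrix is proper if it has no zeros off the main diagonal. -/
def IsProper (r : DistanceMatrix) : Prop := ∀ i j, r.entry i j = 0 → i = j

/-- The north-west corner `p_n(r)` of order `n`. -/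
def corner (r : DistanceMatrix) (n : ℕ) : Fin n → Fin n → ℝ := fun i j => r.entry i j

/-- The set `A(q)` of admissible vectors of a distance matrix `q` of order `n`: those vectors of
distances from one additional point that satisfy all triangle inequalities. -/
def admissible {n : ℕ} (q : Fin n → Fin n → ℝ) : Set (Fin n → ℝ) :=
  {a | ∀ i j, |a i - a j| ≤ q i j ∧ q i j ≤ a i + a j}

/-- Universal distance matrices. -/
def IsUniversal (r : DistanceMatrix) : Prop :=
  ∀ ε : ℝ, 0 < ε → ∀ n : ℕ, ∀ a ∈ admissible (r.corner n),
    ∃ m : ℕ, ∀ i : Fin n, |r.entry i m - a i| < ε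

/-- The set of natural numbers, to be equipped with the (semi)metric `r`. -/
def Points (_r : DistanceMatrix) : Type := ℕ

/-- The (semi)metric on the natural numbers given by `r`; it is a metric if `r` is proper. -/
instance (r : DistanceMatrix) : PseudoMetricSpace r.Points where
  dist := r.entry
  dist_self := r.diag
  dist_comm := r.symm
  dist_triangle i j k := r.triangle i k j

/-- The completion `𝓤_r` of `(ℕ, r)`, with Mathlib's metric on the completion. -/
abbrev Space (r : DistanceMatrix) : Type := UniformSpace.Completion r.Points

/-- The distance matrix of a sequence of points of a metric space. -/
def ofSeq {X : Type u} [MetricSpace X] (x : ℕ → X) : DistanceMatrix where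
  entry i j := dist (x i) (x j)
  diag _ := dist_self _
  nonneg _ _ := dist_nonneg
  symm _ _ := dist_comm _ _
  triangle _ _ _ := dist_triangle _ _ _

end DistanceMatrix

/-- Universality: every Polish (complete separable metric) space embeds isometrically in `U`. -/
def IsPolishUniversal (U : Type u) [MetricSpace U] : Prop :=
  ∀ (Y : Type v) [MetricSpace Y] [CompleteSpace Y] [TopologicalSpace.SeparableSpace Y],
    ∃ f : Y → U, Isometry f

/-- Homogeneity: for any two isometric finite subsets `A = (a_1, …, a_m)`, `B = (b_1, …, b_m)` of
`U` there is an isometry of `U` onto itself that sends `a_i` to `b_i`. -/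
def IsHomogeneousSpace (U : Type u) [MetricSpace U] : Prop :=
  ∀ (m : ℕ) (a b : Fin m → U), (∀ i j, dist (a i) (a j) = dist (b i) (b j)) →
    ∃ J : U ≃ᵢ U, ∀ i, J (a i) = b i

/-- The strong extension property: if `i` embeds a finite subset `F` of `U` isometrically in a
finite metric space `F'`, then some isometric embedding `I` of `F'` in `U` satisfies
`I ∘ i = id` on `F`. -/
def HasFiniteExtension (U : Type u) [MetricSpace U] : Prop :=
  ∀ (F : Set U), F.Finite → ∀ (F' : Type v) [MetricSpace F'] [Finite F'] (i : F → F'),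
    Isometry i → ∃ I : F' → U, Isometry I ∧ ∀ x : F, I (i x) = x

/-- Urysohn spaces: Polish spaces that are universal and homogeneous. -/
structure IsUrysohnSpace (U : Type u) [MetricSpace U] : Prop where
  complete : CompleteSpace U
  separable : TopologicalSpace.SeparableSpace U
  universal : IsPolishUniversal.{u, v} U
  homogeneous : IsHomogeneousSpace U

/-! Everything passes through `HasPointExtension`. Universality of the matrix of a dense sequence
gives it up to an error, since admissible vectors are restrictions of Katetov functions.
Completeness removes the error: an approximate realization improves after a move of about the size
of its error, so the corrections form a geometric series. With exact extension, finite partial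
isometries extend one point at a time. Back and forth (`exists_isometryEquiv`) then yields
uniqueness and homogeneity; the forth half alone (`exists_isometry`) yields universality and finite
extension. Conversely, in a Urysohn space universality realizes the required configuration
somewhere, and homogeneity moves it into place. -/

open Filter Topology

/-! ### Katetov functions -/

/-- Katetov functions: the possible distance functions from one additional point. -/
structure IsKatetov {X : Type*} [MetricSpace X] (f : X → ℝ) : Prop where
  le_add_dist : ∀ x y, f x ≤ f y + dist x y
  dist_le : ∀ x y, dist x y ≤ f x + f y

/-- Every Katetov function is realized on every finite subset, up to any error. -/
def HasApproxPointExtension (X : Type*) [MetricSpace X] : Prop :=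
  ∀ f : X → ℝ, IsKatetov f → ∀ s : Finset X, ∀ ε > 0, ∃ y, ∀ x ∈ s, |dist x y - f x| < ε

/-- Every Katetov function is realized exactly on every finite subset. -/
def HasPointExtension (X : Type*) [MetricSpace X] : Prop :=
  ∀ f : X → ℝ, IsKatetov f → ∀ s : Finset X, ∃ y, ∀ x ∈ s, dist x y = f x

namespace IsKatetov

variable {X : Type*} [MetricSpace X]

theorem nonneg {f : X → ℝ} (hf : IsKatetov f) (x : X) : 0 ≤ f x := by
  have := hf.dist_le x x
  rw [dist_self] at this
  linarith

theorem abs_sub_le {f : X → ℝ} (hf : IsKatetov f) (x y : X) : |f x - f y| ≤ dist x y := by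
  have h₁ := hf.le_add_dist x y
  have h₂ := hf.le_add_dist y x
  rw [dist_comm] at h₂
  rw [abs_le]
  constructor <;> linarith

theorem abs_dist_sub_le {f : X → ℝ} (hf : IsKatetov f) (x y : X) : |dist x y - f y| ≤ f x := by
  have h₁ := hf.dist_le x y
  have h₂ := hf.le_add_dist y x
  rw [dist_comm] at h₂
  rw [abs_le]
  constructor <;> linarith

theorem dist_left (z : X) : IsKatetov fun x => dist x z where
  le_add_dist x y := by linarith [dist_triangle x y z]
  dist_le x y := dist_triangle_right x y z

/-- Admissible distances to a finite family of points extend to a Katetov function. -/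
theorem exists_extension {ι : Type*} [Finite ι] (p : ι → X) (a : ι → ℝ)
    (h₁ : ∀ i j, a i ≤ a j + dist (p i) (p j)) (h₂ : ∀ i j, dist (p i) (p j) ≤ a i + a j) :
    ∃ f : X → ℝ, IsKatetov f ∧ ∀ i, f (p i) = a i := by
  cases nonempty_fintype ι
  rcases isEmpty_or_nonempty ι with hι | hι
  · rcases isEmpty_or_nonempty X with hX | ⟨⟨z⟩⟩
    · exact ⟨fun _ => 0, ⟨fun x => hX.elim x, fun x => hX.elim x⟩, fun i => hι.elim i⟩
    · exact ⟨_, dist_left z, fun i => hι.elim i⟩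
  -- The extension is the largest possible one, `x ↦ min_i (a i + dist x (p i))`; `m x` is an index
  -- attaining the minimum.
  have key : ∀ x, ∃ i, ∀ j, a i + dist x (p i) ≤ a j + dist x (p j) := fun x => by
    obtain ⟨i, -, hi⟩ := Finset.exists_min_image Finset.univ (fun i => a i + dist x (p i))
      Finset.univ_nonempty
    exact ⟨i, fun j => hi j (Finset.mem_univ j)⟩
  choose m hm using key
  refine ⟨fun x => a (m x) + dist x (p (m x)), ⟨fun x y => ?_, fun x y => ?_⟩, fun i => ?_⟩
  · have := hm x (m y)
    have := dist_triangle x y (p (m y))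
    linarith
  · have := h₂ (m x) (m y)
    have := dist_triangle4 x (p (m x)) (p (m y)) y
    rw [dist_comm (p (m y)) y] at this
    linarith
  · refine le_antisymm ?_ ?_
    · simpa using hm (p i) i
    · exact h₁ i _

end IsKatetov

/-! ### From approximate to exact realization -/

section PointExtension

variable {X : Type*} [MetricSpace X]

/-- A point which approximately realizes a Katetov function can be moved, by a distance bounded
by the error, to a point which realizes it more closely. -/
theorem HasApproxPointExtension.exists_dist_lt (hX : HasApproxPointExtension X) {f : X → ℝ}
    (hf : IsKatetov f) {s : Finset X} (hs : s.Nonempty) {y : X} {ε δ : ℝ} (hδ : 0 < δ)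
    (hy : ∀ x ∈ s, |dist x y - f x| ≤ ε) :
    ∃ z, (∀ x ∈ s, |dist x z - f x| < δ) ∧ dist y z < ε + δ := by
  classical
  obtain ⟨w, hw, hmax⟩ := Finset.exists_max_image s (fun x => |dist x y - f x|) hs
  -- Prescribe the distance `η` to `y` along with `f` on `s`. The bound `ε` itself could be too
  -- large to satisfy the triangle inequalities; the attained maximal error always does.
  set η := |dist w y - f w| with hη
  have hη0 : 0 ≤ η := abs_nonneg _
  have hηle : ∀ x ∈ s, dist x y ≤ f x + η ∧ f x ≤ η + dist x y := fun x hx => by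
    have := abs_le.1 (hmax x hx)
    constructor <;> linarith
  have hηf : ∀ x, η ≤ f x + dist x y := fun x => by
    rw [hη, abs_le]
    have := hf.dist_le w x
    have := hf.le_add_dist w x
    have := dist_triangle w x y
    have := dist_triangle_right w x y
    constructor <;> linarith
  obtain ⟨g, hg, hgp⟩ := IsKatetov.exists_extension (ι := Option s)
    (fun o => o.elim y fun x => x) (fun o => o.elim η fun x => f x)
    (by
      rintro (_ | i) (_ | j)
      · simp
      · simpa [dist_comm] using hηf j
      · exact (hηle i i.2).2
      · exact hf.le_add_dist i j)
    (by
      rintro (_ | i) (_ | j)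
      · simpa using hη0
      · simpa [dist_comm, add_comm] using (hηle j j.2).1
      · exact (hηle i i.2).1
      · exact hf.dist_le i j)
  obtain ⟨z, hz⟩ := hX g hg (insert y s) δ hδ
  have hgy : g y = η := hgp none
  refine ⟨z, fun x hx => ?_, ?_⟩
  · have hgx : g x = f x := hgp (some ⟨x, hx⟩)
    rw [← hgx]
    exact hz x (Finset.mem_insert_of_mem hx)
  · have h := (abs_lt.1 (hz y (Finset.mem_insert_self y s))).2
    have := hy w hw
    linarith

theorem HasApproxPointExtension.hasPointExtension [CompleteSpace X]
    (hX : HasApproxPointExtension X) : HasPointExtension X := by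
  intro f hf s
  rcases s.eq_empty_or_nonempty with rfl | hs
  · obtain ⟨y, -⟩ := hX f hf ∅ 1 one_pos
    exact ⟨y, by simp⟩
  obtain ⟨y₀, hy₀⟩ := hX f hf s 1 one_pos
  -- The error hypothesis sits under the existential so that the chosen `F` is total and can be
  -- iterated.
  have step : ∀ (n : ℕ) (y : X), ∃ z, (∀ x ∈ s, |dist x y - f x| ≤ (1 / 2 : ℝ) ^ n) →
      (∀ x ∈ s, |dist x z - f x| ≤ (1 / 2 : ℝ) ^ (n + 1)) ∧ dist y z ≤ 2 * (1 / 2 : ℝ) ^ n := by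
    intro n y
    by_cases hy : ∀ x ∈ s, |dist x y - f x| ≤ (1 / 2 : ℝ) ^ n
    · obtain ⟨z, hz, hyz⟩ := hX.exists_dist_lt hf hs
        (show (0 : ℝ) < (1 / 2) ^ (n + 1) by positivity) hy
      refine ⟨z, fun _ => ⟨fun x hx => (hz x hx).le, hyz.le.trans ?_⟩⟩
      have : (0 : ℝ) < (1 / 2) ^ n := by positivity
      rw [pow_succ]
      linarith
    · exact ⟨y, fun h => absurd h hy⟩
  choose F hF using step
  let u : ℕ → X := fun n => Nat.rec y₀ (fun n y => F n y) n
  have hu : ∀ n, ∀ x ∈ s, |dist x (u n) - f x| ≤ (1 / 2 : ℝ) ^ n := by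
    intro n
    induction n with
    | zero =>
      exact fun x hx => (pow_zero (1 / 2 : ℝ)).symm ▸ (hy₀ x hx).le
    | succ n ih => exact (hF n (u n) ih).1
  have hc : CauchySeq u :=
    cauchySeq_of_le_geometric (1 / 2) 2 (by norm_num) fun n => (hF n (u n) (hu n)).2
  obtain ⟨y, hy⟩ := cauchySeq_tendsto_of_complete hc
  refine ⟨y, fun x hx => ?_⟩
  have h₁ : Tendsto (fun n => |dist x (u n) - f x|) atTop (𝓝 |dist x y - f x|) :=
    ((tendsto_const_nhds.dist hy).sub_const _).abs
  have h₂ : Tendsto (fun n : ℕ => (1 / 2 : ℝ) ^ n) atTop (𝓝 0) :=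
    tendsto_pow_atTop_nhds_zero_of_lt_one (by norm_num) (by norm_num)
  have h₃ := le_of_tendsto_of_tendsto' h₁ h₂ fun n => hu n x hx
  exact sub_eq_zero.1 (abs_nonpos_iff.1 h₃)

end PointExtension

/-! ### Extension from dense subsets -/

section Gluing

variable {X Y ι : Type*} [MetricSpace X] [MetricSpace Y] {p : ι → X} {q : ι → Y}

/-- A distance-preserving correspondence defined on a dense subset extends to an isometric
embedding. -/
theorem DenseRange.exists_isometry_extension [CompleteSpace Y] (hp : DenseRange p)
    (h : ∀ i j, dist (p i) (p j) = dist (q i) (q j)) :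
    ∃ F : X → Y, Isometry F ∧ ∀ i, F (p i) = q i := by
  -- The image of `x` is characterized by its distances to all `q i`, so the choice of approximating
  -- sequence is immaterial.
  have key : ∀ x, ∃ y, ∀ i, dist (q i) y = dist (p i) x := by
    intro x
    have hx : ∀ n : ℕ, ∃ i, dist x (p i) < 1 / ((n : ℝ) + 1) := fun n =>
      hp.exists_dist_lt x (by positivity)
    choose k hk using hx
    have hlim : Tendsto (fun n => p (k n)) atTop (𝓝 x) := by
      rw [tendsto_iff_dist_tendsto_zero]
      refine squeeze_zero (fun _ => dist_nonneg) (fun n => ?_)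
        (tendsto_one_div_add_atTop_nhds_zero_nat (𝕜 := ℝ))
      rw [dist_comm]
      exact (hk n).le
    have hc : CauchySeq fun n => q (k n) := by
      have := hlim.cauchySeq
      rw [Metric.cauchySeq_iff] at this ⊢
      simpa only [← h] using this
    obtain ⟨y, hy⟩ := cauchySeq_tendsto_of_complete hc
    refine ⟨y, fun i => tendsto_nhds_unique (tendsto_const_nhds.dist hy) ?_⟩
    simpa only [← h] using (tendsto_const_nhds (x := p i)).dist hlim
  choose F hF using key
  refine ⟨F, Isometry.of_dist_eq fun x y => ?_, fun i => ?_⟩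
  · refine eq_of_forall_dist_le fun ε hε => ?_
    obtain ⟨i, hi⟩ := hp.exists_dist_lt x (half_pos hε)
    have h₁ := hF x i
    have h₂ := hF y i
    rw [dist_comm] at hi
    have h₃ := dist_triangle_left (F x) (F y) (q i)
    have h₄ := dist_triangle (q i) (F x) (F y)
    have h₅ := dist_triangle_left x y (p i)
    have h₆ := dist_triangle (p i) x y
    rw [Real.dist_eq, abs_le]
    constructor <;> linarith
  · have := hF (p i) i
    rw [dist_self, dist_eq_zero] at this
    exact this.symm

theorem DenseRange.exists_isometryEquiv_extension [CompleteSpace X] [CompleteSpace Y]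
    (hp : DenseRange p) (hq : DenseRange q) (h : ∀ i j, dist (p i) (p j) = dist (q i) (q j)) :
    ∃ J : X ≃ᵢ Y, ∀ i, J (p i) = q i := by
  obtain ⟨F, hF, hFp⟩ := hp.exists_isometry_extension h
  obtain ⟨G, hG, hGq⟩ := hq.exists_isometry_extension fun i j => (h i j).symm
  have hFG : F ∘ G = id :=
    hq.equalizer (hF.continuous.comp hG.continuous) continuous_id
      (funext fun i => by simp [hGq, hFp])
  exact ⟨IsometryEquiv.mk' F G (congrFun hFG) hF, hFp⟩

end Gluing

/-! ### Finite partial isometries and one-point extension -/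

/-- Finite partial isometries between two metric spaces, given by their graphs. -/
def FinitePartialIsometry (X Y : Type*) [MetricSpace X] [MetricSpace Y] : Type _ :=
  {R : Finset (X × Y) // ∀ a ∈ R, ∀ b ∈ R, dist a.1 b.1 = dist a.2 b.2}

namespace FinitePartialIsometry

variable {X Y : Type*} [MetricSpace X] [MetricSpace Y]

instance : PartialOrder (FinitePartialIsometry X Y) := Subtype.partialOrder _

theorem exists_insert (R : FinitePartialIsometry X Y) {x : X} {y : Y}
    (h : ∀ a ∈ R.1, dist a.1 x = dist a.2 y) : ∃ S, R ≤ S ∧ (x, y) ∈ S.1 := by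
  classical
  refine ⟨⟨insert (x, y) R.1, fun a ha b hb => ?_⟩, Finset.subset_insert _ _,
    Finset.mem_insert_self _ _⟩
  rcases Finset.mem_insert.1 ha with rfl | ha <;> rcases Finset.mem_insert.1 hb with rfl | hb
  · simp
  · simpa [dist_comm] using h b hb
  · exact h a ha
  · exact R.2 a ha b hb

theorem exists_image (hY : HasPointExtension Y) (R : FinitePartialIsometry X Y) (x : X) :
    ∃ y, ∀ a ∈ R.1, dist a.1 x = dist a.2 y := by
  classical
  obtain ⟨f, hf, hfR⟩ := IsKatetov.exists_extension (ι := R.1) (fun a => a.1.2)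
    (fun a => dist a.1.1 x)
    (fun a b => by
      rw [← R.2 a a.2 b b.2, add_comm]
      exact dist_triangle _ _ _)
    (fun a b => by
      rw [← R.2 a a.2 b b.2]
      exact dist_triangle_right _ _ _)
  obtain ⟨y, hy⟩ := hY f hf (R.1.image Prod.snd)
  exact ⟨y, fun a ha => by rw [hy _ (Finset.mem_image_of_mem _ ha), hfR ⟨a, ha⟩]⟩

theorem exists_preimage (hX : HasPointExtension X) (R : FinitePartialIsometry X Y) (y : Y) :
    ∃ x, ∀ a ∈ R.1, dist a.1 x = dist a.2 y := by
  classical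
  obtain ⟨f, hf, hfR⟩ := IsKatetov.exists_extension (ι := R.1) (fun a => a.1.1)
    (fun a => dist a.1.2 y)
    (fun a b => by
      rw [R.2 a a.2 b b.2, add_comm]
      exact dist_triangle _ _ _)
    (fun a b => by
      rw [R.2 a a.2 b b.2]
      exact dist_triangle_right _ _ _)
  obtain ⟨x, hx⟩ := hX f hf (R.1.image Prod.fst)
  exact ⟨x, fun a ha => by rw [hx _ (Finset.mem_image_of_mem _ ha), hfR ⟨a, ha⟩]⟩

/-- The partial isometries that are defined at `x` are cofinal. -/
def definedAt (hY : HasPointExtension Y) (x : X) : Order.Cofinal (FinitePartialIsometry X Y) where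
  carrier := {R | ∃ y, (x, y) ∈ R.1}
  isCofinal R := by
    obtain ⟨y, hy⟩ := R.exists_image hY x
    obtain ⟨S, hRS, hS⟩ := R.exists_insert hy
    exact ⟨S, ⟨y, hS⟩, hRS⟩

/-- The partial isometries that have `y` in their range are cofinal. -/
def hitting (hX : HasPointExtension X) (y : Y) : Order.Cofinal (FinitePartialIsometry X Y) where
  carrier := {R | ∃ x, (x, y) ∈ R.1}
  isCofinal R := by
    obtain ⟨x, hx⟩ := R.exists_preimage hX y
    obtain ⟨S, hRS, hS⟩ := R.exists_insert hx
    exact ⟨S, ⟨x, hS⟩, hRS⟩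

/-- The union of the graphs in an ideal of partial isometries. -/
abbrev Graph (I : Order.Ideal (FinitePartialIsometry X Y)) : Type _ :=
  {a : X × Y // ∃ R ∈ I, a ∈ R.1}

/-- An ideal is directed, so any two pairs lie in the graph of one partial isometry. -/
theorem Graph.dist_eq {I : Order.Ideal (FinitePartialIsometry X Y)} (a b : Graph I) :
    dist a.1.1 b.1.1 = dist a.1.2 b.1.2 := by
  obtain ⟨a, R, hR, ha⟩ := a
  obtain ⟨b, S, hS, hb⟩ := b
  obtain ⟨T, -, hRT, hST⟩ := I.directed R hR S hS
  exact T.2 a (hRT ha) b (hST hb)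

/-- The partial isometry with graph `{(a i, b i)}`. -/
noncomputable def ofFamily {ι : Type*} [Fintype ι] [DecidableEq (X × Y)] (a : ι → X) (b : ι → Y)
    (h : ∀ i j, dist (a i) (a j) = dist (b i) (b j)) : FinitePartialIsometry X Y :=
  ⟨Finset.univ.image fun i => (a i, b i), by simpa using h⟩

theorem mem_ofFamily {ι : Type*} [Fintype ι] [DecidableEq (X × Y)] (a : ι → X) (b : ι → Y)
    (h : ∀ i j, dist (a i) (a j) = dist (b i) (b j)) (i : ι) : (a i, b i) ∈ (ofFamily a b h).1 :=
  Finset.mem_image_of_mem _ (Finset.mem_univ i)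

end FinitePartialIsometry

/-! ### Back and forth -/

namespace HasPointExtension

open FinitePartialIsometry TopologicalSpace

variable {X Y ι : Type*} [MetricSpace X] [MetricSpace Y]

theorem nonempty (hX : HasPointExtension X) : Nonempty X := by
  by_contra h
  rw [not_nonempty_iff] at h
  obtain ⟨y, -⟩ := hX (fun _ => 0) ⟨fun x => h.elim x, fun x => h.elim x⟩ ∅
  exact h.elim y

/-- An isometric embedding of a finite subset extends to an isometric embedding of the whole
separable space. -/
theorem exists_isometry [SeparableSpace X] [CompleteSpace Y] (hY : HasPointExtension Y)
    [Finite ι] (a : ι → X) (b : ι → Y) (h : ∀ i j, dist (a i) (a j) = dist (b i) (b j)) :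
    ∃ F : X → Y, Isometry F ∧ ∀ i, F (a i) = b i := by
  classical
  cases nonempty_fintype ι
  rcases isEmpty_or_nonempty X with hX | hX
  · exact ⟨fun x => hX.elim x, fun x => hX.elim x, fun i => hX.elim (a i)⟩
  -- A generic ideal meeting these countably many cofinal sets has dense domain; its range need not
  -- be dense.
  let D : ℕ → Order.Cofinal (FinitePartialIsometry X Y) := fun n => definedAt hY (denseSeq X n)
  let I := Order.idealOfCofinals (ofFamily a b h) D
  have hI : ofFamily a b h ∈ I := Order.mem_idealOfCofinals _ _
  have hp : DenseRange fun c : Graph I => c.1.1 := by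
    refine (denseRange_denseSeq X).mono ?_
    rintro _ ⟨n, rfl⟩
    obtain ⟨R, ⟨y, hy⟩, hR⟩ := Order.cofinal_meets_idealOfCofinals (ofFamily a b h) D n
    exact ⟨⟨(_, y), R, hR, hy⟩, rfl⟩
  obtain ⟨F, hF, hFp⟩ := hp.exists_isometry_extension Graph.dist_eq
  exact ⟨F, hF, fun i => hFp ⟨(a i, b i), _, hI, mem_ofFamily a b h i⟩⟩

/-- Back and forth: an isometry between finite subsets extends to an isometry of the spaces. -/
theorem exists_isometryEquiv [SeparableSpace X] [SeparableSpace Y] [CompleteSpace X]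
    [CompleteSpace Y] (hX : HasPointExtension X) (hY : HasPointExtension Y) [Finite ι]
    (a : ι → X) (b : ι → Y) (h : ∀ i j, dist (a i) (a j) = dist (b i) (b j)) :
    ∃ J : X ≃ᵢ Y, ∀ i, J (a i) = b i := by
  classical
  cases nonempty_fintype ι
  have := hX.nonempty
  have := hY.nonempty
  let D : ℕ ⊕ ℕ → Order.Cofinal (FinitePartialIsometry X Y) :=
    Sum.elim (fun n => definedAt hY (denseSeq X n)) fun n => hitting hX (denseSeq Y n)
  let I := Order.idealOfCofinals (ofFamily a b h) D
  have hI : ofFamily a b h ∈ I := Order.mem_idealOfCofinals _ _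
  have hp : DenseRange fun c : Graph I => c.1.1 := by
    refine (denseRange_denseSeq X).mono ?_
    rintro _ ⟨n, rfl⟩
    obtain ⟨R, ⟨y, hy⟩, hR⟩ :=
      Order.cofinal_meets_idealOfCofinals (ofFamily a b h) D (Sum.inl n)
    exact ⟨⟨(_, y), R, hR, hy⟩, rfl⟩
  have hq : DenseRange fun c : Graph I => c.1.2 := by
    refine (denseRange_denseSeq Y).mono ?_
    rintro _ ⟨n, rfl⟩
    obtain ⟨R, ⟨x, hx⟩, hR⟩ :=
      Order.cofinal_meets_idealOfCofinals (ofFamily a b h) D (Sum.inr n)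
    exact ⟨⟨(x, _), R, hR, hx⟩, rfl⟩
  obtain ⟨J, hJ⟩ := hp.exists_isometryEquiv_extension hq Graph.dist_eq
  exact ⟨J, fun i => hJ ⟨(a i, b i), _, hI, mem_ofFamily a b h i⟩⟩

theorem nonempty_isometryEquiv [SeparableSpace X] [SeparableSpace Y] [CompleteSpace X]
    [CompleteSpace Y] (hX : HasPointExtension X) (hY : HasPointExtension Y) :
    Nonempty (X ≃ᵢ Y) :=
  (hX.exists_isometryEquiv hY (ι := Empty) Empty.elim Empty.elim fun i => i.elim).nonempty

end HasPointExtension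

/-! ### Urysohn spaces and point extension -/

theorem HasPointExtension.isUrysohnSpace {U : Type u} [MetricSpace U] [CompleteSpace U]
    [TopologicalSpace.SeparableSpace U] (hU : HasPointExtension U) :
    IsUrysohnSpace.{u, v} U where
  complete := inferInstance
  separable := inferInstance
  universal Y _ _ _ := by
    obtain ⟨F, hF, -⟩ := hU.exists_isometry (X := Y) (ι := Empty) Empty.elim Empty.elim
      fun i => i.elim
    exact ⟨F, hF⟩
  homogeneous _ a b h := hU.exists_isometryEquiv hU a b h

theorem HasPointExtension.hasFiniteExtension {U : Type u} [MetricSpace U] [CompleteSpace U]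
    (hU : HasPointExtension U) : HasFiniteExtension.{u, v} U := by
  intro F hF F' _ _ i hi
  have : Finite F := hF
  exact hU.exists_isometry i Subtype.val fun x y => hi.dist_eq x y

/-- Realize a Katetov function on a finite subset: embed a finite-dimensional `ℓ^∞` space, which
contains the Kuratowski image of the extended finite subset, and correct the embedding by
homogeneity. -/
theorem IsUrysohnSpace.hasPointExtension {U : Type u} [MetricSpace U]
    (hU : IsUrysohnSpace.{u, v} U) : HasPointExtension U := by
  intro f hf s
  let e := s.equivFin
  let p : Fin s.card → U := fun i => e.symm i
  -- `ULift` places the `ℓ^∞` space in the universe over which universality quantifies.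
  let K : (U → ℝ) → ULift.{v} (Fin s.card → ℝ) := fun g => ⟨fun i => g (p i)⟩
  -- The Katetov inequalities bound every coordinate difference by `g (p i)`, and coordinate `i`
  -- attains it.
  have hK : ∀ g, IsKatetov g → ∀ i, dist (K fun x => dist x (p i)) (K g) = g (p i) := by
    intro g hg i
    rw [ULift.dist_eq]
    refine le_antisymm ((dist_pi_le_iff (hg.nonneg _)).2 fun j => ?_) ?_
    · change |dist (p j) (p i) - g (p j)| ≤ g (p i)
      rw [dist_comm]
      exact hg.abs_dist_sub_le _ _
    · refine le_trans ?_ (dist_le_pi_dist _ _ i)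
      simp only [K, dist_self, Real.dist_eq, zero_sub, abs_neg]
      exact le_abs_self _
  have : TopologicalSpace.SeparableSpace (ULift.{v} (Fin s.card → ℝ)) :=
    (Homeomorph.ulift.{v} (X := Fin s.card → ℝ)).symm.surjective.denseRange
      |>.separableSpace Homeomorph.ulift.symm.continuous
  obtain ⟨φ, hφ⟩ := hU.universal (ULift.{v} (Fin s.card → ℝ))
  obtain ⟨J, hJ⟩ := hU.homogeneous s.card (fun i => φ (K fun x => dist x (p i))) p fun i j => by
    rw [hφ.dist_eq, hK _ (IsKatetov.dist_left _)]
  refine ⟨J (φ (K f)), fun x hx => ?_⟩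
  have hx' : p (e ⟨x, hx⟩) = x := by simp [p]
  have := hJ (e ⟨x, hx⟩)
  rw [hx'] at this
  conv_lhs => rw [← this]
  rw [J.isometry.dist_eq, hφ.dist_eq]
  simpa only [hx'] using hK f hf (e ⟨x, hx⟩)

/-! ### Universal matrices and point extension -/

namespace DistanceMatrix

/-- The vector of values of a Katetov function on a sequence is approximated by distances to
terms of the sequence. -/
theorem IsUniversal.hasApproxPointExtension {X : Type*} [MetricSpace X] {x : ℕ → X}
    (h : (ofSeq x).IsUniversal) (hx : DenseRange x) : HasApproxPointExtension X := by
  intro f hf s ε hε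
  have hδ : 0 < ε / 3 := by positivity
  choose k hk using fun u => hx.exists_dist_lt u hδ
  -- The corner must include the index `s.sup k`, hence the `+ 1`. Replacing `u` by `x (k u)` costs
  -- `ε / 3` in the distance and again in `f`.
  obtain ⟨m, hm⟩ := h (ε / 3) hδ (s.sup k + 1) (fun i => f (x i))
    fun i j => ⟨hf.abs_sub_le _ _, hf.dist_le _ _⟩
  refine ⟨x m, fun u hu => ?_⟩
  have h₁ : |dist (x (k u)) (x m) - f (x (k u))| < ε / 3 :=
    hm ⟨k u, Nat.lt_succ_of_le (Finset.le_sup hu)⟩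
  have h₂ := abs_lt.1 h₁
  have h₃ := abs_le.1 (hf.abs_sub_le u (x (k u)))
  have h₄ := hk u
  have h₅ := dist_triangle u (x (k u)) (x m)
  have h₆ := dist_triangle_left (x (k u)) (x m) u
  rw [abs_lt]
  constructor <;> linarith

/-- Extend the admissible vector to a Katetov function, realize it exactly, and approximate the
realizing point by a term of the sequence. -/
theorem _root_.HasPointExtension.isUniversal_ofSeq {X : Type*} [MetricSpace X]
    (h : HasPointExtension X) {x : ℕ → X} (hx : DenseRange x) : (ofSeq x).IsUniversal := by
  classical
  intro ε hε n a ha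
  obtain ⟨f, hf, hfa⟩ := IsKatetov.exists_extension (fun i : Fin n => x i) a
    (fun i j => by
      have : |a i - a j| ≤ dist (x i) (x j) := (ha i j).1
      linarith [(abs_le.1 this).2])
    (fun i j => (ha i j).2)
  obtain ⟨y, hy⟩ := h f hf (Finset.univ.image fun i : Fin n => x i)
  obtain ⟨m, hm⟩ := hx.exists_dist_lt y hε
  refine ⟨m, fun i => ?_⟩
  rw [← hfa i, ← hy (x i) (Finset.mem_image_of_mem _ (Finset.mem_univ i))]
  refine lt_of_le_of_lt ?_ hm
  change |dist (x i) (x m) - dist (x i) y| ≤ dist y (x m)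
  rw [dist_comm (x i) (x m), dist_comm (x i) y, dist_comm y (x m)]
  exact abs_dist_sub_le _ _ _

/-- The points of `ℕ` in the completion. -/
def toSpace (r : DistanceMatrix) (n : ℕ) : r.Space := UniformSpace.Completion.coe' (α := r.Points) n

theorem denseRange_toSpace (r : DistanceMatrix) : DenseRange r.toSpace :=
  UniformSpace.Completion.denseRange_coe (α := r.Points)

instance (r : DistanceMatrix) : TopologicalSpace.SeparableSpace r.Space :=
  ⟨_, Set.countable_range r.toSpace, r.denseRange_toSpace⟩

theorem ofSeq_toSpace (r : DistanceMatrix) : (ofSeq r.toSpace).entry = r.entry := by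
  funext i j
  exact UniformSpace.Completion.dist_eq (α := r.Points) i j

theorem IsUniversal.hasPointExtension_space {r : DistanceMatrix} (h : r.IsUniversal) :
    HasPointExtension r.Space := by
  have h' : (ofSeq r.toSpace).IsUniversal := by
    unfold IsUniversal corner
    rw [ofSeq_toSpace]
    exact h
  exact (h'.hasApproxPointExtension r.denseRange_toSpace).hasPointExtension

end DistanceMatrix

theorem theorem3 :
    -- `𝓤_r` is a Urysohn space, has the strong extension property, and is, up to isometry, the
    -- only Urysohn space
    (∀ r : DistanceMatrix, r.IsProper → r.IsUniversal →
      IsUrysohnSpace.{0, v} r.Space ∧ HasFiniteExtension.{0, v} r.Space ∧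
        ∀ (X : Type u) [MetricSpace X], IsUrysohnSpace.{u, v} X → Nonempty (r.Space ≃ᵢ X)) ∧
    -- uniqueness
    (∀ r r' : DistanceMatrix, r.IsProper → r.IsUniversal → r'.IsProper → r'.IsUniversal →
      Nonempty (r.Space ≃ᵢ r'.Space)) ∧
    -- universality of the distance matrix of a dense sequence characterizes the Urysohn space
    (∀ (X : Type u) [MetricSpace X] [CompleteSpace X] [TopologicalSpace.SeparableSpace X]
      (x : ℕ → X), DenseRange x →
        ((DistanceMatrix.ofSeq x).IsUniversal ↔ IsUrysohnSpace.{u, v} X)) := by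
  refine ⟨fun r _ hr => ?_, fun r r' _ hr _ hr' => ?_,
    fun X _ _ _ x hx => ⟨fun h => ?_, fun h => ?_⟩⟩
  · have hU := hr.hasPointExtension_space
    refine ⟨hU.isUrysohnSpace, hU.hasFiniteExtension, fun X _ hX => ?_⟩
    have := hX.complete
    have := hX.separable
    exact hU.nonempty_isometryEquiv hX.hasPointExtension
  · exact hr.hasPointExtension_space.nonempty_isometryEquiv hr'.hasPointExtension_space
  · exact (h.hasApproxPointExtension hx).hasPointExtension.isUrysohnSpace
  · exact h.hasPointExtension.isUniversal_ofSeq hx
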